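/- **Conventions.** Matrices are complex $n\times n$, $n\ge 1$ arbitrary. $A\ge 0$ means positive semidefinite, $A>0$ positive definite, and $s(A)$ is the support projection of $A\ge 0$ (the orthogonal projection onto its range); projections are compared in the Loewner order. $A^{-1}$ is the generalized inverse of $A\ge0$ (the inverse on the support, $0$ on the kernel), and $A^{r}:=(A^{-1})^{-r}$ for $r<0$. For $\alpha>1$, $p>0$ and $A,B\ge0$ with $s(A)\ge s(B)$ put \[ A\#B:=A^{1/2}(A^{-1/2}BA^{-1/2})^{1/2}A^{1/2},\qquad F_\alpha(A,B):=(A^{-1}\#B)^{\alpha}A(A^{-1}\#B)^{\alpha}, \] \[ SG_{\alpha,p}(A,B):=F_\alpha(A^p,B^p)^{1/p},\qquad R_{\alpha,p}(A,B):=\bigl(A^{\frac{1-\alpha}{2}p}B^{\alpha p}A^{\frac{1-\alpha}{2}p}\bigr)^{1/p}. \] For $n\times n$ matrices $X,Y\ge0$ with eigenvalues $\lambda_1(X)\ge\dots\ge\lambda_n(X)$ and $\lambda_1(Y)\ge\dots\ge\lambda_n(Y)$, counted with multiplicity, $X\prec_{\log}Y$ means that $\prod_{i=1}^k\lambda_i(X)\le\prod_{i=1}^k\lambda_i(Y)$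 for $1\le k\le n$, with equality for $k=n$. **Theorem 3.4.** Let $\alpha>1$ and $p,q>0$. 1. If $p/q\le\alpha$, then $SG_{\alpha,p}(A,B)\prec_{\log}R_{\alpha,q}(A,B)$ for all $A,B\ge0$ (of the same, arbitrary size) with $s(A)\ge s(B)$. 2. There exist $2\times2$ positive definite matrices $A,B$ such that $R_{\alpha,q}(A,B)\not\prec_{\log}SG_{\alpha,p}(A,B)$. -/

import Mathlib

open scoped ComplexOrder MatrixOrder

namespace QuasiMeans

/-- `A ^ r` for a matrix `A ≥ 0` and a real exponent `r` is Mathlib's functional calculus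
`CFC.rpow`, i.e. the function `x ↦ x ^ r` on `[0, ∞)` applied to the eigenvalues of `A`. Since
`(0 : ℝ≥0) ^ r = 0` for every `r ≠ 0`, the power `A ^ (-1 : ℝ)` is the generalized inverse of `A`
(inverse on the support, zero on the kernel), and `A ^ r` for `r < 0` is the `(-r)`-th power of
the generalized inverse. The exponent `0` does not occur below for the parameters of interest.

The order `≤` on matrices is the Loewner order.

`supp A` is the support projection `s(A)` of `A ≥ 0`: the spectral projection of `A` for the set
of nonzero eigenvalues, that is, the orthogonal projection onto the range of `A`. -/
noncomputable def supp {n : ℕ} (A : Matrix (Fin n) (Fin n) ℂ) : Matrix (Fin n) (Fin n) ℂ :=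
  cfc (fun x : ℝ => if x = 0 then 0 else 1) A

/-- The weighted geometric mean `A #_t B = A^{1/2} (A^{-1/2} B A^{-1/2})^t A^{1/2}`, for
`A, B ≥ 0` with `s(A) ≥ s(B)`. -/
noncomputable def geomMean {n : ℕ} (t : ℝ) (A B : Matrix (Fin n) (Fin n) ℂ) :
    Matrix (Fin n) (Fin n) ℂ :=
  A ^ (1 / 2 : ℝ) * (A ^ (-(1 / 2) : ℝ) * B * A ^ (-(1 / 2) : ℝ)) ^ t * A ^ (1 / 2 : ℝ)

/-- The weighted spectral geometric mean `F_α(A, B) = (A⁻¹ # B)^α A (A⁻¹ # B)^α`, where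
`# = #_{1/2}` and `A⁻¹` is the generalized inverse, for `A, B ≥ 0` with `s(A) ≥ s(B)`. -/
noncomputable def specGeomMean {n : ℕ} (α : ℝ) (A B : Matrix (Fin n) (Fin n) ℂ) :
    Matrix (Fin n) (Fin n) ℂ :=
  (geomMean (1 / 2) (A ^ (-1 : ℝ)) B) ^ α * A * (geomMean (1 / 2) (A ^ (-1 : ℝ)) B) ^ α

/-- The quasi weighted spectral geometric mean `SG_{α,p}(A, B) = F_α(A^p, B^p)^{1/p}`. -/
noncomputable def SG {n : ℕ} (α p : ℝ) (A B : Matrix (Fin n) (Fin n) ℂ) :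
    Matrix (Fin n) (Fin n) ℂ :=
  (specGeomMean α (A ^ p) (B ^ p)) ^ (1 / p)

/-- The Rényi mean `R_{α,p}(A, B) = (A^{(1-α)p/2} B^{αp} A^{(1-α)p/2})^{1/p}`. -/
noncomputable def R {n : ℕ} (α p : ℝ) (A B : Matrix (Fin n) (Fin n) ℂ) :
    Matrix (Fin n) (Fin n) ℂ :=
  (A ^ ((1 - α) / 2 * p) * B ^ (α * p) * A ^ ((1 - α) / 2 * p)) ^ (1 / p)

theorem SG_posSemidef {n : ℕ} (α p : ℝ) (A B : Matrix (Fin n) (Fin n) ℂ) :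
    (SG α p A B).PosSemidef :=
  Matrix.nonneg_iff_posSemidef.mp CFC.rpow_nonneg

theorem R_posSemidef {n : ℕ} (α p : ℝ) (A B : Matrix (Fin n) (Fin n) ℂ) :
    (R α p A B).PosSemidef :=
  Matrix.nonneg_iff_posSemidef.mp CFC.rpow_nonneg

/-- The eigenvalues of a positive semidefinite matrix, with multiplicities, in decreasing order
(`Matrix.IsHermitian.eigenvalues₀` is decreasing): `eig hX 0 ≥ eig hX 1 ≥ … ≥ eig hX (n - 1)`. -/
noncomputable def eig {n : ℕ} {X : Matrix (Fin n) (Fin n) ℂ} (hX : X.PosSemidef) : Fin n → ℝ :=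
  fun i => hX.isHermitian.eigenvalues₀ (Fin.cast (Fintype.card_fin n).symm i)

/-- Log-majorization `X ≺_log Y` of positive semidefinite matrices: the product of the `k` largest
eigenvalues of `X` is at most that of `Y` for `1 ≤ k ≤ n`, with equality for `k = n`. -/
def LogMajorizedBy {n : ℕ} (X Y : Matrix (Fin n) (Fin n) ℂ)
    (hX : X.PosSemidef) (hY : Y.PosSemidef) : Prop :=
  (∀ k : ℕ, 1 ≤ k → k ≤ n →
    ∏ i : Fin n with i.val < k, eig hX i ≤ ∏ i : Fin n with i.val < k, eig hY i) ∧
  ∏ i : Fin n, eig hX i = ∏ i : Fin n, eig hY i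

end QuasiMeans

/-! For `A > 0` the matrix `G = A⁻¹ # B` is the positive solution of the Riccati equation
`G A G = B`. If `B ^ (α q) ≤ κ A ^ ((α - 1) q)`, i.e. `‖R_{α,q}(A, B)‖ ^ q ≤ κ`, then repeated use
of the Löwner–Heinz inequality on the Riccati equation `G A ^ p G = B ^ p` bounds
`G ^ α A ^ p G ^ α = F_α(A ^ p, B ^ p)` by `κ ^ (p / q)`; this is where `p / q ≤ α` enters. Hence
`‖SG_{α,p}‖ ≤ ‖R_{α,q}‖`.

The norm of the `k`-th compound matrix of `X ≥ 0` is the product of the `k` largest eigenvalues of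
`X`, and compounds commute with products and real powers. Applying the norm inequality to compounds
therefore gives the log-majorization, the determinants of both means being
`det A ^ (1 - α) * det B ^ α`. A singular `A` is replaced by its extension by the identity on its
kernel, which changes neither mean.

For the second part let `A = diag(1, 2)` and let `B` tend to the projection onto `(1, 1)`. At the
limit both norms are explicit, and strict convexity, `2 ^ (x / 2) < (1 + 2 ^ x) / 2` for `x ≠ 0`,
gives `‖SG_{α,p}‖ < ‖R_{α,q}‖`. -/

namespace QuasiMeans

lemma norm_of_isStarProjection {E : Type*} [NonUnitalNormedRing E] [StarRing E] [CStarRing E]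
    {e : E} (he : IsStarProjection e) (h0 : e ≠ 0) : ‖e‖ = 1 := by
  have h := CStarRing.norm_star_mul_self (x := e)
  rw [he.isSelfAdjoint.star_eq, he.isIdempotentElem.eq] at h
  exact (mul_eq_right₀ (norm_ne_zero_iff.mpr h0)).mp h.symm

section CStarAlgebra

variable {𝔄 : Type*} [CStarAlgebra 𝔄] [PartialOrder 𝔄] [StarOrderedRing 𝔄]
  {a b c g v : 𝔄} {α δ θ κ p q t x y z : ℝ}

lemma star_rpow (a : 𝔄) (x : ℝ) : star (a ^ x) = a ^ x :=
  CFC.rpow_nonneg.isSelfAdjoint.star_eq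

lemma rpow_mul_rpow (ha : IsStrictlyPositive a) (h : x + y = z) : a ^ x * a ^ y = a ^ z := by
  rw [← h, CFC.rpow_add ha.isUnit]

lemma rpow_rpow (ha : IsStrictlyPositive a) (x y : ℝ) : (a ^ x) ^ y = a ^ (x * y) := by
  rcases eq_or_ne x 0 with rfl | hx
  · rw [zero_mul, CFC.rpow_zero a, CFC.one_rpow]
  · exact CFC.rpow_rpow a x y hx

lemma rpow_mul_rpow_of_exponent_nonneg (a : 𝔄) (hx : 0 ≤ x) (hy : 0 ≤ y) (h : x + y = z) :
    a ^ x * a ^ y = a ^ z := by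
  simp only [CFC.rpow_def]
  rw [← cfc_mul _ _ a (NNReal.continuousOn_rpow_const (.inr hx))
    (NNReal.continuousOn_rpow_const (.inr hy))]
  exact cfc_congr fun t _ => by rw [← h, NNReal.rpow_add_of_nonneg t hx hy]

lemma smul_rpow (ha : 0 ≤ a) {r : ℝ} (hr : 0 ≤ r) (hx : 0 ≤ x) : (r • a) ^ x = r ^ x • a ^ x := by
  lift r to NNReal using hr
  have hcont (s : Set NNReal) : ContinuousOn (fun t : NNReal => t ^ x) s :=
    NNReal.continuousOn_rpow_const (.inr hx)
  change (r • a) ^ x = (r ^ x : NNReal) • a ^ x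
  rw [CFC.rpow_def, CFC.rpow_def, ← cfc_smul _ _ a (hcont _),
    ← cfc_comp_smul (R := NNReal) r (fun t => t ^ x) a (hcont _) ha]
  exact cfc_congr fun t _ => by simp only [smul_eq_mul, NNReal.mul_rpow]

lemma rpow_conj_rpow_neg (ha : IsStrictlyPositive a) (x : ℝ) (b : 𝔄) :
    a ^ x * (a ^ (-x) * b * a ^ (-x)) * a ^ x = b := by
  calc _ = a ^ x * a ^ (-x) * b * (a ^ (-x) * a ^ x) := by noncomm_ring
    _ = b := by rw [CFC.rpow_mul_rpow_neg x ha, CFC.rpow_neg_mul_rpow x ha, one_mul, mul_one]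

lemma rpow_conj_le_iff (ha : IsStrictlyPositive a) :
    a ^ x * b * a ^ x ≤ c ↔ b ≤ a ^ (-x) * c * a ^ (-x) := by
  refine ⟨fun h => ?_, fun h => ?_⟩
  · have := conjugate_le_conjugate_of_nonneg h (CFC.rpow_nonneg (a := a) (y := -x))
    have hb := rpow_conj_rpow_neg ha (-x) b
    rw [neg_neg] at hb
    rwa [hb] at this
  · have := conjugate_le_conjugate_of_nonneg h (CFC.rpow_nonneg (a := a) (y := x))
    rwa [rpow_conj_rpow_neg ha] at this

lemma rpow_conj_le_smul_one_iff (ha : IsStrictlyPositive a) (h : y = -2 * x) :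
    a ^ x * b * a ^ x ≤ κ • (1 : 𝔄) ↔ b ≤ κ • a ^ y := by
  rw [rpow_conj_le_iff ha, mul_smul_comm, mul_one, smul_mul_assoc,
    rpow_mul_rpow ha (z := y) (by rw [h]; ring)]

lemma star_mul_self_le_one_iff : star a * a ≤ 1 ↔ a * star a ≤ 1 := by
  rw [← CStarAlgebra.norm_le_one_iff_of_nonneg _ (mul_star_self_nonneg a),
    ← CStarAlgebra.norm_le_one_iff_of_nonneg _ (star_mul_self_nonneg a),
    CStarRing.norm_self_mul_star, CStarRing.norm_star_mul_self]

lemma rpow_conj_rpow_le_one_iff (ha : IsStrictlyPositive a) (hx : 0 ≤ x) :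
    b ^ x * a ^ y * b ^ x ≤ 1 ↔ b ^ (2 * x) ≤ a ^ (-y) := by
  have hstar : star (a ^ (y / 2) * b ^ x) = b ^ x * a ^ (y / 2) := by
    rw [star_mul, star_rpow, star_rpow]
  have hleft : star (a ^ (y / 2) * b ^ x) * (a ^ (y / 2) * b ^ x) = b ^ x * a ^ y * b ^ x := by
    rw [hstar, ← rpow_mul_rpow ha (add_halves y)]
    noncomm_ring
  have hright : a ^ (y / 2) * b ^ x * star (a ^ (y / 2) * b ^ x)
      = a ^ (y / 2) * b ^ (2 * x) * a ^ (y / 2) := by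
    rw [hstar, ← rpow_mul_rpow_of_exponent_nonneg b hx hx (two_mul x).symm]
    noncomm_ring
  rw [← hleft, star_mul_self_le_one_iff, hright, ← one_smul ℝ (1 : 𝔄),
    rpow_conj_le_smul_one_iff (y := -y) ha (by ring), one_smul]

lemma conj_rpow_sub_one_le (ha : IsStrictlyPositive a) (hv : 0 ≤ v) (hδ : δ ≤ 1)
    (hθ : 0 ≤ θ) (hθ' : θ ≤ 1) (h : v ^ (2 : ℝ) ≤ a ^ (2 - δ)) :
    v * a ^ (θ - 1) * v ≤ a ^ (1 + θ - δ) := by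
  have hd : 0 < 2 - δ := by linarith
  -- `γ` is chosen so that Löwner–Heinz turns `v ^ 2 ≤ a ^ (2 - δ)` into
  -- `v ^ (2 * γ) ≤ a ^ (1 - θ)`.
  set γ := (1 - θ) / (2 - δ) with hγ
  have hγ0 : 0 ≤ γ := div_nonneg (by linarith) hd.le
  have hγ1 : γ ≤ 1 := by rw [hγ, div_le_one hd]; linarith
  have hmul : (2 - δ) * γ = 1 - θ := mul_div_cancel₀ _ hd.ne'
  have hpow {r : ℝ} (hr : 0 ≤ r) (hr' : r ≤ 1) : v ^ (2 * r) ≤ a ^ ((2 - δ) * r) := by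
    have := CFC.rpow_le_rpow ⟨hr, hr'⟩ h
    rwa [CFC.rpow_rpow_of_exponent_nonneg v 2 r two_pos.le hr,
      CFC.rpow_rpow_of_exponent_nonneg a _ r hd.le hr] at this
  have hone : v ^ γ * a ^ (θ - 1) * v ^ γ ≤ 1 := by
    rw [rpow_conj_rpow_le_one_iff ha hγ0, neg_sub, ← hmul]
    exact hpow hγ0 hγ1
  have hsplit {r s : ℝ} (hr : 0 ≤ r) (hs : 0 ≤ s) (hrs : r + s = 1) : v ^ r * v ^ s = v := by
    rw [rpow_mul_rpow_of_exponent_nonneg v hr hs hrs, CFC.rpow_one v]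
  calc v * a ^ (θ - 1) * v
      = (v ^ (1 - γ) * v ^ γ) * a ^ (θ - 1) * (v ^ γ * v ^ (1 - γ)) := by
        rw [hsplit (by linarith) hγ0 (by ring), hsplit hγ0 (by linarith) (by ring)]
    _ = v ^ (1 - γ) * (v ^ γ * a ^ (θ - 1) * v ^ γ) * v ^ (1 - γ) := by noncomm_ring
    _ ≤ v ^ (1 - γ) * 1 * v ^ (1 - γ) := conjugate_le_conjugate_of_nonneg hone CFC.rpow_nonneg
    _ = v ^ (2 * (1 - γ)) := by
        rw [mul_one, rpow_mul_rpow_of_exponent_nonneg v (by linarith) (by linarith)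
          (two_mul _).symm]
    _ ≤ a ^ ((2 - δ) * (1 - γ)) := hpow (by linarith) (by linarith)
    _ = a ^ (1 + θ - δ) := by rw [mul_one_sub, hmul]; ring_nf

lemma conj_rpow_le_rpow_sub (ha : IsStrictlyPositive a) (hg : 0 ≤ g) (hδ : δ ≤ 1)
    (hθ : 0 ≤ θ) (hθ' : θ ≤ 1) (h : g * a * g ≤ a ^ (1 - δ)) :
    g * a ^ θ * g ≤ a ^ (θ - δ) := by
  have hconj {r s : ℝ} (x : ℝ) (hrs : r + x + r = s) : a ^ r * a ^ x * a ^ r = a ^ s := by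
    rw [rpow_mul_rpow ha rfl, rpow_mul_rpow ha hrs]
  set v := a ^ (1 / 2 : ℝ) * g * a ^ (1 / 2 : ℝ) with hv
  have hv0 : 0 ≤ v := conjugate_nonneg_of_nonneg hg CFC.rpow_nonneg
  have hv2 : v ^ (2 : ℝ) ≤ a ^ (2 - δ) := calc
    v ^ (2 : ℝ) = v * v := by
        rw [← pow_two, ← CFC.rpow_natCast v 2, Nat.cast_ofNat]
    _ = a ^ (1 / 2 : ℝ) * (g * (a ^ (1 / 2 : ℝ) * a ^ (1 / 2 : ℝ)) * g) * a ^ (1 / 2 : ℝ) := by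
        rw [hv]; noncomm_ring
    _ = a ^ (1 / 2 : ℝ) * (g * a * g) * a ^ (1 / 2 : ℝ) := by
        rw [rpow_mul_rpow ha (add_halves 1), CFC.rpow_one a]
    _ ≤ a ^ (1 / 2 : ℝ) * a ^ (1 - δ) * a ^ (1 / 2 : ℝ) :=
        conjugate_le_conjugate_of_nonneg h CFC.rpow_nonneg
    _ = a ^ (2 - δ) := hconj _ (by ring)
  have hgθ : a ^ (1 / 2 : ℝ) * (g * a ^ θ * g) * a ^ (1 / 2 : ℝ) = v * a ^ (θ - 1) * v := by
    rw [← hconj (r := 1 / 2) (θ - 1) (s := θ) (by ring), hv]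
    noncomm_ring
  rw [← hconj (r := -(1 / 2)) (1 + θ - δ) (s := θ - δ) (by ring), ← rpow_conj_le_iff ha, hgθ]
  exact conj_rpow_sub_one_le ha hv0 hδ hθ hθ' hv2

lemma rpow_conj_rpow_mul_le_one (ha : IsStrictlyPositive a) (hg : 0 ≤ g) (hδ : 0 ≤ δ)
    (hδ' : δ ≤ 1) (h : g * a * g ≤ a ^ (1 - δ)) (ht : 0 ≤ t) (htδ : t * δ ≤ 1) :
    g ^ t * a ^ (t * δ) * g ^ t ≤ 1 := by
  obtain ⟨n, hn⟩ := exists_nat_ge t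
  have hconj {θ : ℝ} (hθ : 0 ≤ θ) (hθ' : θ ≤ 1) : g * a ^ θ * g ≤ a ^ (θ - δ) :=
    conj_rpow_le_rpow_sub ha hg hδ' hθ hθ' h
  have hbase : g ^ (2 : ℝ) ≤ a ^ (-δ) := by
    have := (rpow_conj_rpow_le_one_iff (b := g) (y := δ) ha zero_le_one).mp
    rw [CFC.rpow_one g, mul_one] at this
    exact this (by simpa only [sub_self, CFC.rpow_zero a] using hconj hδ hδ')
  -- Each conjugation by `g` lowers the exponent of `a` by `δ`; the remaining fractional power of
  -- `g` is handled by Löwner–Heinz applied to `g ^ 2 ≤ a ^ (-δ)`.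
  induction n generalizing t with
  | zero =>
    obtain rfl : t = 0 := le_antisymm (by exact_mod_cast hn) ht
    simp only [zero_mul, CFC.rpow_zero a, CFC.rpow_zero g, mul_one, le_refl]
  | succ n ih =>
    rcases le_total t 1 with ht1 | ht1
    · rw [rpow_conj_rpow_le_one_iff ha ht]
      have := CFC.rpow_le_rpow ⟨ht, ht1⟩ hbase
      rwa [CFC.rpow_rpow_of_exponent_nonneg g 2 t two_pos.le ht, rpow_rpow ha, neg_mul,
        mul_comm δ] at this
    · have hδt : (t - 1) * δ = t * δ - δ := by ring
      have hleft : g ^ (t - 1) * g = g ^ t := by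
        rw [← rpow_mul_rpow_of_exponent_nonneg g (by linarith) zero_le_one (sub_add_cancel t 1),
          CFC.rpow_one g]
      have hright : g * g ^ (t - 1) = g ^ t := by
        rw [← rpow_mul_rpow_of_exponent_nonneg g zero_le_one (by linarith) (add_sub_cancel 1 t),
          CFC.rpow_one g]
      calc g ^ t * a ^ (t * δ) * g ^ t
          = g ^ (t - 1) * (g * a ^ (t * δ) * g) * g ^ (t - 1) := by
            nth_rw 1 [← hleft]
            rw [← hright]
            noncomm_ring
        _ ≤ g ^ (t - 1) * a ^ ((t - 1) * δ) * g ^ (t - 1) := by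
            rw [hδt]
            exact conjugate_le_conjugate_of_nonneg (hconj (by positivity) htδ) CFC.rpow_nonneg
        _ ≤ 1 := ih (by linarith) (by linarith) (by push_cast at hn; linarith)

lemma rpow_conj_self_le_one (ha : IsStrictlyPositive a) (hg : 0 ≤ g) (hα : 1 ≤ α)
    (h : g * a * g ≤ a ^ (1 - 1 / α)) : g ^ α * a * g ^ α ≤ 1 := by
  have hα0 : 0 < α := one_pos.trans_le hα
  have hαα : α * (1 / α) = 1 := mul_one_div_cancel hα0.ne'
  have := rpow_conj_rpow_mul_le_one ha hg (one_div_nonneg.mpr hα0.le)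
    ((div_le_one hα0).mpr hα) h hα0.le hαα.le
  rwa [hαα, CFC.rpow_one a] at this

lemma rpow_conj_self_le_smul_one (ha : IsStrictlyPositive a) (hg : 0 ≤ g) (hα : 1 ≤ α)
    (hκ : 0 < κ) (h : g * a * g ≤ κ • a ^ (1 - 1 / α)) :
    g ^ α * a * g ^ α ≤ κ ^ α • (1 : 𝔄) := by
  have hs : 0 ≤ κ ^ (-(1 / 2) : ℝ) := by positivity
  have hs2 : κ ^ (-(1 / 2) : ℝ) * κ ^ (-(1 / 2) : ℝ) = κ⁻¹ := by
    rw [← Real.rpow_add hκ, ← Real.rpow_neg_one]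
    norm_num
  have hsα : (κ ^ (-(1 / 2) : ℝ)) ^ α * (κ ^ (-(1 / 2) : ℝ)) ^ α = (κ ^ α)⁻¹ := by
    rw [← Real.mul_rpow hs hs, hs2, Real.inv_rpow hκ.le]
  have hscaled := rpow_conj_self_le_one ha (smul_nonneg hs hg) hα (by
    rw [smul_mul_assoc, mul_smul_comm, smul_mul_assoc, smul_smul, hs2]
    exact (inv_smul_le_iff_of_pos hκ).mpr h)
  rw [smul_rpow hg hs (by linarith), smul_mul_assoc, mul_smul_comm, smul_mul_assoc, smul_smul,
    hsα] at hscaled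
  exact (inv_smul_le_iff_of_pos (by positivity)).mp hscaled

/-- The Riccati equation `g * a ^ p * g = b ^ p` says that `g` is the geometric mean of `a ^ (-p)`
and `b ^ p`, so that `g ^ α * a ^ p * g ^ α` is `F_α(a ^ p, b ^ p)`. -/
lemma norm_rpow_conj_le (ha : IsStrictlyPositive a) (hb : 0 ≤ b) (hg : 0 ≤ g) (hα : 1 ≤ α)
    (hp : 0 < p) (hq : 0 < q) (hpq : p / q ≤ α) (h : g * a ^ p * g = b ^ p) :
    ‖g ^ α * a ^ p * g ^ α‖ ≤
      ‖a ^ ((1 - α) / 2 * q) * b ^ (α * q) * a ^ ((1 - α) / 2 * q)‖ ^ (p / q) := by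
  have hα0 : 0 < α := one_pos.trans_le hα
  set N := ‖a ^ ((1 - α) / 2 * q) * b ^ (α * q) * a ^ ((1 - α) / 2 * q)‖
  have hbound {κ : ℝ} (hκ : N < κ) : ‖g ^ α * a ^ p * g ^ α‖ ≤ κ ^ (p / q) := by
    have hκ0 : 0 < κ := (norm_nonneg _).trans_lt hκ
    have hle : b ^ (α * q) ≤ κ • a ^ ((α - 1) * q) := by
      rw [← rpow_conj_le_smul_one_iff (x := (1 - α) / 2 * q) ha (by ring),
        ← Algebra.algebraMap_eq_smul_one]
      exact (CStarAlgebra.norm_le_iff_le_algebraMap _ hκ0.le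
        (conjugate_nonneg_of_nonneg CFC.rpow_nonneg CFC.rpow_nonneg)).mp hκ.le
    have hs0 : 0 ≤ p / (α * q) := by positivity
    have hs1 : p / (α * q) ≤ 1 := by
      rw [mul_comm, ← div_div]
      exact (div_le_one hα0).mpr hpq
    have hpow : g * a ^ p * g ≤ κ ^ (p / (α * q)) • (a ^ p) ^ (1 - 1 / α) := by
      have := CFC.rpow_le_rpow ⟨hs0, hs1⟩ hle
      rw [smul_rpow CFC.rpow_nonneg hκ0.le hs0, rpow_rpow ha,
        CFC.rpow_rpow_of_exponent_nonneg b _ _ (by positivity) hs0] at this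
      rw [h, rpow_rpow ha]
      convert this using 3 <;> field_simp
    have hmain := rpow_conj_self_le_smul_one (.rpow a p) hg hα (by positivity) hpow
    rw [← Real.rpow_mul hκ0.le, ← Algebra.algebraMap_eq_smul_one,
      show p / (α * q) * α = p / q by field_simp] at hmain
    exact (CStarAlgebra.norm_le_iff_le_algebraMap _ (by positivity)
      (conjugate_nonneg_of_nonneg CFC.rpow_nonneg CFC.rpow_nonneg)).mpr hmain
  have hlim : Filter.Tendsto (fun κ : ℝ => κ ^ (p / q)) (nhdsWithin N (Set.Ioi N))
      (nhds (N ^ (p / q))) :=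
    (Real.continuousAt_rpow_const N _ (.inr (by positivity))).tendsto.mono_left
      nhdsWithin_le_nhds
  exact ge_of_tendsto hlim (eventually_mem_nhdsWithin.mono fun κ hκ => hbound hκ)

lemma eq_of_conj_eq_conj {k : 𝔄} (ha : IsStrictlyPositive a) (hg : 0 ≤ g) (hk : 0 ≤ k)
    (h : g * a * g = k * a * k) : g = k := by
  have hsq (b : 𝔄) : (a ^ (1 / 2 : ℝ) * b * a ^ (1 / 2 : ℝ)) ^ 2
      = a ^ (1 / 2 : ℝ) * (b * a * b) * a ^ (1 / 2 : ℝ) := by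
    nth_rw 4 [← CFC.rpow_one a]
    rw [← rpow_mul_rpow ha (add_halves 1)]
    noncomm_ring
  have hconj : a ^ (1 / 2 : ℝ) * g * a ^ (1 / 2 : ℝ) = a ^ (1 / 2 : ℝ) * k * a ^ (1 / 2 : ℝ) :=
    (CFC.sq_eq_sq_iff _ _ (conjugate_nonneg_of_nonneg hg CFC.rpow_nonneg)
      (conjugate_nonneg_of_nonneg hk CFC.rpow_nonneg)).mp (by rw [hsq, hsq, h])
  have hu : IsUnit (a ^ (1 / 2 : ℝ)) := (IsStrictlyPositive.rpow a (1 / 2)).isUnit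
  exact hu.mul_left_cancel (hu.mul_right_cancel hconj)

lemma continuousOn_rpow_comp {X : Type*} [TopologicalSpace X] {f : X → 𝔄} {S : Set X}
    (hf : ContinuousOn f S) (hf0 : ∀ u ∈ S, 0 ≤ f u) {r : ℝ} (hr : 0 < r) :
    ContinuousOn (fun u => f u ^ r) S := by
  lift r to NNReal using hr.le
  have hc := CFC.continuousOn_nnrpow (A := 𝔄) r
  simp only [CFC.nnrpow_eq_rpow (NNReal.coe_pos.mp hr)] at hc
  exact hc.comp hf hf0

lemma rpow_of_isStarProjection (ha : IsStarProjection a) (hx : x ≠ 0) : a ^ x = a := by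
  rw [CFC.rpow_eq_cfc_real ha.nonneg]
  refine (cfc_congr fun t ht => ?_).trans (cfc_id ℝ a ha.isSelfAdjoint)
  rcases (isIdempotentElem_iff_spectrum_subset ℝ a ha.isSelfAdjoint).mp ha.isIdempotentElem ht
    with h | h
  · simp only [h, Real.zero_rpow hx, id]
  · simp only [Set.mem_singleton_iff.mp h, Real.one_rpow, id]

lemma norm_rpow_conj_of_isStarProjection (ha : IsStrictlyPositive a) (hb : IsStarProjection b) :
    ‖a ^ x * b * a ^ x‖ = ‖b * a ^ (2 * x) * b‖ := by
  have hstar : star (b * a ^ x) = a ^ x * b := by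
    rw [star_mul, star_rpow, hb.isSelfAdjoint.star_eq]
  calc ‖a ^ x * b * a ^ x‖ = ‖star (b * a ^ x) * (b * a ^ x)‖ := by
        nth_rw 1 [hstar, ← hb.isIdempotentElem.eq]
        simp only [mul_assoc]
    _ = ‖b * a ^ x * star (b * a ^ x)‖ := by
        rw [CStarRing.norm_star_mul_self, CStarRing.norm_self_mul_star]
    _ = ‖b * a ^ (2 * x) * b‖ := by
        rw [hstar, ← rpow_mul_rpow ha (two_mul x).symm]
        simp only [mul_assoc]

end CStarAlgebra

open scoped Matrix.Norms.L2Operator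

section Means

variable {n : ℕ} {A B G : Matrix (Fin n) (Fin n) ℂ} {α p q : ℝ}

lemma geomMean_nonneg (t : ℝ) (A B : Matrix (Fin n) (Fin n) ℂ) : 0 ≤ geomMean t A B :=
  conjugate_nonneg_of_nonneg CFC.rpow_nonneg CFC.rpow_nonneg

lemma specGeomMean_nonneg (α : ℝ) (hA : 0 ≤ A) (B : Matrix (Fin n) (Fin n) ℂ) :
    0 ≤ specGeomMean α A B :=
  conjugate_nonneg_of_nonneg hA CFC.rpow_nonneg

lemma geomMean_riccati (hA : IsStrictlyPositive A) (hB : 0 ≤ B) :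
    geomMean (1 / 2) (A ^ (-1 : ℝ)) B * A * geomMean (1 / 2) (A ^ (-1 : ℝ)) B = B := by
  set M := A ^ (1 / 2 : ℝ) * B * A ^ (1 / 2 : ℝ)
  have hM : 0 ≤ M := conjugate_nonneg_of_nonneg hB CFC.rpow_nonneg
  have hgeom : geomMean (1 / 2) (A ^ (-1 : ℝ)) B =
      A ^ (-(1 / 2) : ℝ) * M ^ (1 / 2 : ℝ) * A ^ (-(1 / 2) : ℝ) := by
    rw [geomMean, rpow_rpow hA, rpow_rpow hA, neg_one_mul, neg_one_mul, neg_neg]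
  have hA1 : A ^ (-(1 / 2) : ℝ) * A * A ^ (-(1 / 2) : ℝ) = 1 := by
    nth_rw 2 [← CFC.rpow_one A]
    rw [rpow_mul_rpow hA rfl, rpow_mul_rpow hA (z := 0) (by norm_num), CFC.rpow_zero A]
  calc _ = A ^ (-(1 / 2) : ℝ) * (M ^ (1 / 2 : ℝ) *
        (A ^ (-(1 / 2) : ℝ) * A * A ^ (-(1 / 2) : ℝ)) * M ^ (1 / 2 : ℝ)) * A ^ (-(1 / 2) : ℝ) := by
        rw [hgeom]; noncomm_ring
    _ = A ^ (-(1 / 2) : ℝ) * M * A ^ (-(1 / 2) : ℝ) := by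
        rw [hA1, mul_one, rpow_mul_rpow_of_exponent_nonneg M (by norm_num) (by norm_num)
          (add_halves 1), CFC.rpow_one M]
    _ = B := by simpa only [neg_neg] using rpow_conj_rpow_neg hA (-(1 / 2)) B

lemma geomMean_eq_of_riccati (hA : IsStrictlyPositive A) (hG : 0 ≤ G) (h : G * A * G = B) :
    geomMean (1 / 2) (A ^ (-1 : ℝ)) B = G := by
  have hB : 0 ≤ B := h ▸ conjugate_nonneg_of_nonneg hA.nonneg hG
  exact eq_of_conj_eq_conj hA (geomMean_nonneg _ _ _) hG ((geomMean_riccati hA hB).trans h.symm)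

lemma continuousOn_SG (A : Matrix (Fin n) (Fin n) ℂ) (hα : 0 < α) (hp : 0 < p) :
    ContinuousOn (SG α p A) {B | 0 ≤ B} := by
  have hpow : ContinuousOn (fun B : Matrix (Fin n) (Fin n) ℂ => B ^ p) {B | 0 ≤ B} :=
    continuousOn_rpow_comp continuousOn_id (fun _ h => h) hp
  have hgeom : ContinuousOn (fun B => geomMean (1 / 2) ((A ^ p) ^ (-1 : ℝ)) (B ^ p)) {B | 0 ≤ B} :=
    (continuousOn_const.mul (continuousOn_rpow_comp
      ((continuousOn_const.mul hpow).mul continuousOn_const)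
      (fun _ _ => conjugate_nonneg_of_nonneg CFC.rpow_nonneg CFC.rpow_nonneg)
      one_half_pos)).mul continuousOn_const
  have hgeomα := continuousOn_rpow_comp hgeom (fun _ _ => geomMean_nonneg _ _ _) hα
  exact continuousOn_rpow_comp ((hgeomα.mul continuousOn_const).mul hgeomα)
    (fun _ _ => specGeomMean_nonneg α CFC.rpow_nonneg _) (one_div_pos.mpr hp)

lemma continuousOn_R (A : Matrix (Fin n) (Fin n) ℂ) (hα : 0 < α) (hq : 0 < q) :
    ContinuousOn (R α q A) {B | 0 ≤ B} :=
  continuousOn_rpow_comp ((continuousOn_const.mul (continuousOn_rpow_comp continuousOn_id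
    (fun _ h => h) (by positivity))).mul continuousOn_const)
    (fun _ _ => conjugate_nonneg_of_nonneg CFC.rpow_nonneg CFC.rpow_nonneg) (one_div_pos.mpr hq)

end Means

section Support

lemma continuousOn_spectrum {m : Type*} [Fintype m] [DecidableEq m] (f : ℝ → ℝ)
    (A : Matrix m m ℂ) : ContinuousOn f (spectrum ℝ A) :=
  Matrix.finite_real_spectrum.continuousOn f

lemma cfc_rpow {m : Type*} [Fintype m] [DecidableEq m] {A : Matrix m m ℂ} (hA : IsSelfAdjoint A)
    {f : ℝ → ℝ} (hf : ∀ s ∈ spectrum ℝ A, 0 ≤ f s) (x : ℝ) :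
    cfc f A ^ x = cfc (fun s => f s ^ x) A := by
  rw [CFC.rpow_eq_cfc_real (cfc_nonneg hf)]
  exact (cfc_comp (fun s : ℝ => s ^ x) f A hA
    ((Matrix.finite_real_spectrum.image _).continuousOn _) (continuousOn_spectrum f A)).symm

variable {n : ℕ} {A B P X : Matrix (Fin n) (Fin n) ℂ} {α p q t x : ℝ}

lemma rpow_rpow_of_nonneg (hA : 0 ≤ A) (x y : ℝ) : (A ^ x) ^ y = A ^ (x * y) := by
  have hspec {s : ℝ} (hs : s ∈ spectrum ℝ A) : 0 ≤ s := spectrum_nonneg_of_nonneg hA hs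
  rw [CFC.rpow_eq_cfc_real hA, CFC.rpow_eq_cfc_real hA,
    cfc_rpow hA.isSelfAdjoint fun s hs => Real.rpow_nonneg (hspec hs) x]
  exact cfc_congr fun s hs => (Real.rpow_mul (hspec hs) x y).symm

lemma supp_isStarProjection (A : Matrix (Fin n) (Fin n) ℂ) : IsStarProjection (supp A) := by
  refine ⟨?_, cfc_predicate _ A⟩
  rw [IsIdempotentElem, supp,
    ← cfc_mul _ _ A (continuousOn_spectrum _ A) (continuousOn_spectrum _ A)]
  exact cfc_congr fun s _ => by split_ifs <;> norm_num

lemma supp_mul_cfc {f g : ℝ → ℝ} (hg : g 0 = 0)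
    (hfg : ∀ s ∈ spectrum ℝ A, s ≠ 0 → f s = g s) : supp A * cfc f A = cfc g A := by
  rw [supp, ← cfc_mul _ _ A (continuousOn_spectrum _ A) (continuousOn_spectrum _ A)]
  refine cfc_congr fun s hs => ?_
  rcases eq_or_ne s 0 with rfl | hs0
  · simp only [if_true, zero_mul, hg]
  · simp only [if_neg hs0, one_mul, hfg s hs hs0]

lemma supp_mul_rpow (hA : 0 ≤ A) (hx : x ≠ 0) : supp A * A ^ x = A ^ x := by
  rw [CFC.rpow_eq_cfc_real hA]
  exact supp_mul_cfc (Real.zero_rpow hx) fun _ _ _ => rfl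

lemma supp_mul_self (hA : 0 ≤ A) : supp A * A = A := by
  simpa only [CFC.rpow_one A] using supp_mul_rpow hA one_ne_zero

lemma mul_rpow_neg_one (hA : 0 ≤ A) : A * A ^ (-1 : ℝ) = supp A := by
  nth_rw 1 [← cfc_id ℝ A hA.isSelfAdjoint]
  rw [CFC.rpow_eq_cfc_real hA, supp,
    ← cfc_mul _ _ A (continuousOn_spectrum _ A) (continuousOn_spectrum _ A)]
  refine cfc_congr fun s _ => ?_
  rcases eq_or_ne s 0 with rfl | hs
  · simp only [if_true, id, zero_mul]
  · simp only [if_neg hs, id, Real.rpow_neg_one, mul_inv_cancel₀ hs]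

lemma supp_mul_of_supp_le (hB : 0 ≤ B) (h : supp B ≤ supp A) : supp A * B = B := by
  have := ((supp_isStarProjection A).mul_right_and_mul_left_of_nonneg_of_le
    (supp_isStarProjection B).nonneg h).2
  rw [← supp_mul_self hB, ← mul_assoc, this]

lemma mul_rpow_of_mul_eq (hX : 0 ≤ X) (h : P * X = X) (hx : x ≠ 0) : P * X ^ x = X ^ x := by
  have hsupp : P * supp X = supp X := by rw [← mul_rpow_neg_one hX, ← mul_assoc, h]
  rw [← supp_mul_rpow hX hx, ← mul_assoc, hsupp]

lemma mul_supp_of_supp_mul (hX : 0 ≤ X) (h : supp A * X = X) : X * supp A = X := by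
  simpa only [star_mul, hX.isSelfAdjoint.star_eq,
    (supp_isStarProjection A).isSelfAdjoint.star_eq] using congrArg star h

/-- The matrix that agrees with `A ≥ 0` on the support of `A` and is the identity on its kernel. It
reduces statements about `A ≥ 0` to the strictly positive case. -/
noncomputable def unitExtension (A : Matrix (Fin n) (Fin n) ℂ) : Matrix (Fin n) (Fin n) ℂ :=
  cfc (fun s : ℝ => if s = 0 then 1 else s) A

lemma unitExtension_isStrictlyPositive (hA : 0 ≤ A) : IsStrictlyPositive (unitExtension A) := by
  have hpos {s : ℝ} (hs : s ∈ spectrum ℝ A) : 0 < if s = 0 then 1 else s := by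
    split_ifs with h
    exacts [one_pos, (spectrum_nonneg_of_nonneg hA hs).lt_of_ne' h]
  refine IsUnit.isStrictlyPositive ?_ (cfc_nonneg fun s hs => (hpos hs).le)
  rw [unitExtension, isUnit_cfc_iff _ A (continuousOn_spectrum _ A)]
  exact fun s hs => (hpos hs).ne'

lemma supp_mul_unitExtension_rpow (hA : 0 ≤ A) (hx : x ≠ 0) :
    supp A * unitExtension A ^ x = A ^ x := by
  rw [unitExtension, cfc_rpow hA.isSelfAdjoint, CFC.rpow_eq_cfc_real hA]
  · exact supp_mul_cfc (Real.zero_rpow hx) fun s _ hs => by rw [if_neg hs]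
  · intro s hs
    split_ifs
    exacts [zero_le_one, spectrum_nonneg_of_nonneg hA hs]

lemma unitExtension_rpow_conj (hA : 0 ≤ A) (hX : 0 ≤ X) (h : supp A * X = X) (hx : x ≠ 0) :
    unitExtension A ^ x * X * unitExtension A ^ x = A ^ x * X * A ^ x := by
  have hright : unitExtension A ^ x * supp A = A ^ x := by
    simpa only [star_mul, star_rpow, (supp_isStarProjection A).isSelfAdjoint.star_eq] using
      congrArg star (supp_mul_unitExtension_rpow hA hx)
  calc unitExtension A ^ x * X * unitExtension A ^ x
      = unitExtension A ^ x * (supp A * X * supp A) * unitExtension A ^ x := by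
        rw [h, mul_supp_of_supp_mul hX h]
    _ = unitExtension A ^ x * supp A * X * (supp A * unitExtension A ^ x) := by noncomm_ring
    _ = A ^ x * X * A ^ x := by rw [hright, supp_mul_unitExtension_rpow hA hx]

lemma supp_mul_geomMean_rpow (hA : 0 ≤ A) (hx : x ≠ 0) :
    supp A * geomMean t (A ^ x) B = geomMean t (A ^ x) B := by
  have hx2 : x * (1 / 2) ≠ 0 := mul_ne_zero hx (by norm_num)
  rw [geomMean, rpow_rpow_of_nonneg hA, ← mul_assoc, ← mul_assoc, supp_mul_rpow hA hx2]

lemma geomMean_unitExtension_rpow (hA : 0 ≤ A) (hB : 0 ≤ B) (h : supp A * B = B) (ht : t ≠ 0)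
    (hx : x ≠ 0) : geomMean t (unitExtension A ^ x) B = geomMean t (A ^ x) B := by
  have hx2 : x * (1 / 2) ≠ 0 := mul_ne_zero hx (by norm_num)
  have hx2' : x * -(1 / 2) ≠ 0 := mul_ne_zero hx (by norm_num)
  have hinner : supp A * (A ^ (x * -(1 / 2)) * B * A ^ (x * -(1 / 2)))
      = A ^ (x * -(1 / 2)) * B * A ^ (x * -(1 / 2)) := by
    rw [← mul_assoc, ← mul_assoc, supp_mul_rpow hA hx2']
  have hU := (unitExtension_isStrictlyPositive hA).nonneg
  simp only [geomMean, rpow_rpow_of_nonneg hA, rpow_rpow_of_nonneg hU]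
  rw [unitExtension_rpow_conj hA hB h hx2', unitExtension_rpow_conj hA CFC.rpow_nonneg
    (mul_rpow_of_mul_eq (conjugate_nonneg_of_nonneg hB CFC.rpow_nonneg) hinner ht) hx2]

lemma R_unitExtension (hA : 0 ≤ A) (hB : 0 ≤ B) (h : supp A * B = B) (hα : 1 < α) (hq : 0 < q) :
    R α q (unitExtension A) B = R α q A B := by
  have hx : α * q ≠ 0 := by positivity
  have hy : (1 - α) / 2 * q ≠ 0 :=
    mul_ne_zero (div_ne_zero (by linarith) two_ne_zero) hq.ne'
  rw [R, R, unitExtension_rpow_conj hA CFC.rpow_nonneg (mul_rpow_of_mul_eq hB h hx) hy]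

lemma SG_unitExtension (hA : 0 ≤ A) (hB : 0 ≤ B) (h : supp A * B = B) (hα : α ≠ 0) (hp : p ≠ 0) :
    SG α p (unitExtension A) B = SG α p A B := by
  have hU := (unitExtension_isStrictlyPositive hA).nonneg
  have hp' : p * -1 ≠ 0 := mul_ne_zero hp (by norm_num)
  have hBp : supp A * B ^ p = B ^ p := mul_rpow_of_mul_eq hB h hp
  have hG := geomMean_nonneg (1 / 2) (A ^ (p * -1)) (B ^ p)
  have hPG := mul_rpow_of_mul_eq hG (supp_mul_geomMean_rpow hA hp') hα
  have hGP := mul_supp_of_supp_mul CFC.rpow_nonneg hPG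
  rw [SG, SG, specGeomMean, specGeomMean, rpow_rpow_of_nonneg hA, rpow_rpow_of_nonneg hU,
    geomMean_unitExtension_rpow hA CFC.rpow_nonneg hBp (by norm_num) hp', ← hGP,
    mul_assoc _ (supp A), supp_mul_unitExtension_rpow hA hp, mul_assoc _ (supp A),
    supp_mul_rpow hA hp]

end Support

section Diagonalization

open Matrix

variable {m : Type*} [Fintype m] [DecidableEq m] {V : Matrix m m ℂ} {d : m → ℝ}

lemma isSelfAdjoint_unitary_conj_diagonal (V : Matrix m m ℂ) (d : m → ℝ) :
    IsSelfAdjoint (V * diagonal (fun i => (d i : ℂ)) * star V) :=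
  (isHermitian_diagonal_of_self_adjoint _
    (funext fun i => Complex.conj_ofReal (d i))).isSelfAdjoint.conjugate V

lemma cfc_unitary_conj_diagonal (hV : V ∈ unitaryGroup m ℂ) (d : m → ℝ) (f : ℝ → ℝ) :
    cfc f (V * diagonal (fun i => (d i : ℂ)) * star V) =
      V * diagonal (fun i => (f (d i) : ℂ)) * star V := by
  let φ : (m → ℝ) →ₐ[ℝ] Matrix m m ℂ :=
    (AlgHomClass.toAlgHom (Unitary.conjStarAlgAut ℝ _ ⟨V, hV⟩)).comp
      ((diagonalAlgHom ℝ).comp (Complex.ofRealAm.compLeft m))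
  have hspec : (spectrum ℝ (φ d)).Finite := finite_real_spectrum
  -- `f` agrees with a polynomial on the finitely many relevant points, and `φ` commutes with
  -- polynomials.
  let r : Polynomial ℝ := Lagrange.interpolate (hspec.toFinset ∪ Finset.univ.image d) id f
  have hr {s : ℝ} (hs : s ∈ hspec.toFinset ∪ Finset.univ.image d) : f s = r.eval s :=
    (Lagrange.eval_interpolate_at_node f (Set.injOn_id _) hs).symm
  calc cfc f (φ d) = cfc r.eval (φ d) :=
        cfc_congr fun s hs => hr (Finset.mem_union_left _ (hspec.mem_toFinset.mpr hs))
    _ = Polynomial.aeval (φ d) r := cfc_polynomial r _ (isSelfAdjoint_unitary_conj_diagonal V d)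
    _ = φ (Polynomial.aeval d r) := Polynomial.aeval_algHom_apply φ d r
    _ = φ (fun i => f (d i)) := by
        rw [Polynomial.aeval_pi_apply]
        exact congrArg φ (funext fun i => (hr (Finset.mem_union_right _
          (Finset.mem_image_of_mem d (Finset.mem_univ i)))).symm)

lemma unitary_conj_diagonal_nonneg (V : Matrix m m ℂ) (hd : 0 ≤ d) :
    0 ≤ V * diagonal (fun i => (d i : ℂ)) * star V := by
  refine star_right_conjugate_nonneg ?_ V
  rw [nonneg_iff_posSemidef, posSemidef_diagonal_iff]
  exact fun i => Complex.zero_le_real.mpr (hd i)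

lemma unitary_conj_diagonal_rpow (hV : V ∈ unitaryGroup m ℂ) (hd : 0 ≤ d) (x : ℝ) :
    (V * diagonal (fun i => (d i : ℂ)) * star V) ^ x =
      V * diagonal (fun i => ((d i ^ x : ℝ) : ℂ)) * star V := by
  rw [CFC.rpow_eq_cfc_real (unitary_conj_diagonal_nonneg V hd), cfc_unitary_conj_diagonal hV]

lemma norm_unitary_conj_diagonal (hV : V ∈ unitaryGroup m ℂ) (hd : 0 ≤ d) {i : m}
    (hi : ∀ j, d j ≤ d i) : ‖V * diagonal (fun j => (d j : ℂ)) * star V‖ = d i := by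
  rw [CStarRing.norm_mul_mem_unitary _ (Unitary.star_mem hV), CStarRing.norm_mem_unitary_mul _ hV,
    l2_opNorm_diagonal]
  have hnorm (j : m) : ‖(d j : ℂ)‖ = d j := Complex.norm_of_nonneg (hd j)
  refine le_antisymm ((pi_norm_le_iff_of_nonneg (hd i)).mpr fun j => (hnorm j).trans_le (hi j)) ?_
  exact (hnorm i).symm.trans_le (norm_le_pi_norm (fun j => (d j : ℂ)) i)

lemma norm_det_unitary_conj_diagonal (hV : V ∈ unitaryGroup m ℂ) (hd : 0 ≤ d) :
    ‖(V * diagonal (fun i => (d i : ℂ)) * star V).det‖ = ∏ i, d i := by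
  rw [det_mul_comm, ← mul_assoc, (Unitary.mem_iff.mp hV).1, one_mul, det_diagonal, norm_prod]
  exact Finset.prod_congr rfl fun i _ => Complex.norm_of_nonneg (hd i)

end Diagonalization

section Eigenvalues

open Matrix

variable {n : ℕ} {A B X : Matrix (Fin n) (Fin n) ℂ} {α p q : ℝ}

lemma eig_antitone (hX : X.PosSemidef) : Antitone (eig hX) := fun _ _ hij =>
  hX.isHermitian.eigenvalues₀_antitone hij

lemma eig_eq_eigenvalues (hX : X.PosSemidef) :
    ∃ σ : Equiv.Perm (Fin n), ∀ i, eig hX i = hX.isHermitian.eigenvalues (σ i) := by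
  refine ⟨(finCongr (Fintype.card_fin n).symm).trans
    (Fintype.equivOfCardEq (Fintype.card_fin _)), fun i => ?_⟩
  simp [eig, IsHermitian.eigenvalues]

lemma eig_nonneg (hX : X.PosSemidef) : 0 ≤ eig hX := fun i => by
  obtain ⟨σ, hσ⟩ := eig_eq_eigenvalues hX
  exact (hX.eigenvalues_nonneg (σ i)).trans_eq (hσ i).symm

lemma exists_unitary_eig (hX : X.PosSemidef) : ∃ V ∈ unitaryGroup (Fin n) ℂ,
    X = V * diagonal (fun i => (eig hX i : ℂ)) * star V := by
  obtain ⟨σ, hσ⟩ := eig_eq_eigenvalues hX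
  let U : Matrix (Fin n) (Fin n) ℂ := hX.isHermitian.eigenvectorUnitary
  have hU : star U * U = 1 := Unitary.coe_star_mul_self hX.isHermitian.eigenvectorUnitary
  refine ⟨U.submatrix id σ, mem_unitaryGroup_iff'.mpr ?_, ?_⟩
  · rw [star_eq_conjTranspose, conjTranspose_submatrix,
      ← submatrix_mul _ _ _ id _ Function.bijective_id, ← star_eq_conjTranspose, hU,
      submatrix_one_equiv]
  · have hdiag : diagonal (fun i => (eig hX i : ℂ)) =
        (diagonal (fun i => (hX.isHermitian.eigenvalues i : ℂ))).submatrix σ σ := by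
      simp only [submatrix_diagonal_equiv, hσ]
      rfl
    rw [hdiag, star_eq_conjTranspose, conjTranspose_submatrix, submatrix_mul_equiv,
      submatrix_mul_equiv, submatrix_id_id]
    exact hX.isHermitian.spectral_theorem

lemma norm_eq_eig_zero (hX : X.PosSemidef) (hn : 0 < n) : ‖X‖ = eig hX ⟨0, hn⟩ := by
  obtain ⟨V, hV, h⟩ := exists_unitary_eig hX
  conv_lhs => rw [h]
  exact norm_unitary_conj_diagonal hV (eig_nonneg hX) fun j => eig_antitone hX (Nat.zero_le j)

lemma norm_det_eq_prod_eig (hX : X.PosSemidef) : ‖X.det‖ = ∏ i, eig hX i := by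
  obtain ⟨V, hV, h⟩ := exists_unitary_eig hX
  conv_lhs => rw [h]
  exact norm_det_unitary_conj_diagonal hV (eig_nonneg hX)

lemma norm_det_rpow (hX : 0 ≤ X) (x : ℝ) : ‖(X ^ x).det‖ = ‖X.det‖ ^ x := by
  have hX' := nonneg_iff_posSemidef.mp hX
  obtain ⟨V, hV, h⟩ := exists_unitary_eig hX'
  have h0 := eig_nonneg hX'
  rw [h, unitary_conj_diagonal_rpow hV h0, norm_det_unitary_conj_diagonal hV h0,
    norm_det_unitary_conj_diagonal hV fun i => Real.rpow_nonneg (h0 i) x,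
    Real.finsetProd_rpow _ _ fun i _ => h0 i]

lemma norm_det_pos (hA : IsUnit A) : 0 < ‖A.det‖ :=
  norm_pos_iff.mpr ((isUnit_iff_isUnit_det A).mp hA).ne_zero

lemma norm_det_R (hA : IsStrictlyPositive A) (hB : 0 ≤ B) (hq : q ≠ 0) :
    ‖(R α q A B).det‖ = ‖A.det‖ ^ (1 - α) * ‖B.det‖ ^ α := by
  have h : 0 ≤ A ^ ((1 - α) / 2 * q) * B ^ (α * q) * A ^ ((1 - α) / 2 * q) :=
    conjugate_nonneg_of_nonneg CFC.rpow_nonneg CFC.rpow_nonneg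
  have ha : 0 < ‖A.det‖ := norm_det_pos hA.isUnit
  have hb : 0 ≤ ‖B.det‖ := norm_nonneg _
  rw [R, norm_det_rpow h, det_mul, det_mul, norm_mul, norm_mul, norm_det_rpow hA.nonneg,
    norm_det_rpow hB, mul_right_comm, ← Real.rpow_add ha, Real.mul_rpow (by positivity)
    (by positivity), ← Real.rpow_mul ha.le, ← Real.rpow_mul hb]
  congr 2 <;> field_simp
  ring

lemma norm_det_SG (hA : IsStrictlyPositive A) (hB : 0 ≤ B) (hp : p ≠ 0) :
    ‖(SG α p A B).det‖ = ‖A.det‖ ^ (1 - α) * ‖B.det‖ ^ α := by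
  have ha : 0 < ‖A.det‖ := norm_det_pos hA.isUnit
  have hb : 0 ≤ ‖B.det‖ := norm_nonneg _
  set G := geomMean (1 / 2) ((A ^ p) ^ (-1 : ℝ)) (B ^ p)
  have hG : ‖G.det‖ * ‖A.det‖ ^ p * ‖G.det‖ = ‖B.det‖ ^ p := by
    rw [← norm_det_rpow hA.nonneg, ← norm_det_rpow hB, ← norm_mul, ← norm_mul, ← det_mul,
      ← det_mul, geomMean_riccati (.rpow A p) CFC.rpow_nonneg]
  have hG' : ‖G.det‖ ^ (2 : ℝ) = ‖A.det‖ ^ (-p) * ‖B.det‖ ^ p := by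
    rw [Real.rpow_neg ha.le, ← hG, Real.rpow_two]
    field_simp
  rw [SG, norm_det_rpow (specGeomMean_nonneg α CFC.rpow_nonneg _), specGeomMean, det_mul, det_mul,
    norm_mul, norm_mul, norm_det_rpow (geomMean_nonneg _ _ _), norm_det_rpow hA.nonneg]
  calc (‖G.det‖ ^ α * ‖A.det‖ ^ p * ‖G.det‖ ^ α) ^ (1 / p)
      = ((‖G.det‖ ^ (2 : ℝ)) ^ α * ‖A.det‖ ^ p) ^ (1 / p) := by
        rw [← Real.rpow_mul (norm_nonneg _), mul_comm 2 α, Real.rpow_mul (norm_nonneg _),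
          Real.rpow_two]
        congr 1
        ring
    _ = ‖A.det‖ ^ (1 - α) * ‖B.det‖ ^ α := by
        rw [hG', Real.mul_rpow (x := ‖A.det‖ ^ (-p)) (by positivity) (by positivity),
          ← Real.rpow_mul ha.le, ← Real.rpow_mul hb, mul_right_comm, ← Real.rpow_add ha,
          Real.mul_rpow (by positivity) (by positivity), ← Real.rpow_mul ha.le, ← Real.rpow_mul hb]
        congr 2 <;> field_simp
        ring

end Eigenvalues

section Compound

open Matrix

section CauchyBinet

variable {R m : Type*} [CommRing R] {k : ℕ}

lemma det_mul_eq_sum_fun [Fintype m] (M : Matrix (Fin k) m R) (N : Matrix m (Fin k) R) :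
    (M * N).det = ∑ f : Fin k → m, (M.submatrix id f).det * ∏ i, N (f i) i := by
  classical
  simp only [det_apply', mul_apply, Finset.prod_univ_sum, Finset.mul_sum, Finset.sum_mul,
    Fintype.piFinset_univ]
  rw [Finset.sum_comm]
  refine Finset.sum_congr rfl fun f _ => Finset.sum_congr rfl fun σ _ => ?_
  rw [Finset.prod_mul_distrib, mul_assoc]
  rfl

lemma det_submatrix_mul_det_submatrix (M : Matrix (Fin k) m R) (N : Matrix m (Fin k) R)
    (f : Fin k → m) : (M.submatrix id f).det * (N.submatrix f id).det =
      ∑ σ : Equiv.Perm (Fin k), (M.submatrix id (f ∘ σ)).det * ∏ i, N (f (σ i)) i := by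
  rw [det_apply' (N.submatrix f id), Finset.mul_sum]
  refine Finset.sum_congr rfl fun σ _ => ?_
  have hσ : (M.submatrix id (f ∘ σ)).det = Equiv.Perm.sign σ * (M.submatrix id f).det :=
    det_permute' σ (M.submatrix id f)
  rw [hσ]
  simp only [submatrix_apply, id]
  ring

variable [LinearOrder m]

lemma injective_orderEmbedding_comp_perm :
    Function.Injective fun x : (Fin k ↪o m) × Equiv.Perm (Fin k) => x.1 ∘ x.2 := by
  rintro ⟨e, σ⟩ ⟨e', σ'⟩ (h : e ∘ σ = e' ∘ σ')
  obtain rfl : e = e' := by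
    rw [← OrderEmbedding.range_inj, ← σ.surjective.range_comp e, h, σ'.surjective.range_comp]
  rw [Equiv.ext fun i => e.injective (congrFun h i)]

lemma exists_orderEmbedding_comp_perm {f : Fin k → m} (hf : Function.Injective f) :
    ∃ (e : Fin k ↪o m) (σ : Equiv.Perm (Fin k)), e ∘ σ = f := by
  have hmono : StrictMono (f ∘ Tuple.sort f) :=
    (Tuple.monotone_sort f).strictMono_of_injective (hf.comp (Tuple.sort f).injective)
  refine ⟨OrderEmbedding.ofStrictMono _ hmono, (Tuple.sort f)⁻¹, funext fun i => ?_⟩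
  exact congrArg f (Equiv.apply_symm_apply (Tuple.sort f) i)

/-- The **Cauchy–Binet formula**. -/
theorem det_mul_eq_sum_orderEmbedding [Fintype m] (M : Matrix (Fin k) m R)
    (N : Matrix m (Fin k) R) :
    (M * N).det = ∑ e : Fin k ↪o m, (M.submatrix id e).det * (N.submatrix e id).det := by
  simp only [det_submatrix_mul_det_submatrix]
  rw [← Fintype.sum_prod_type', det_mul_eq_sum_fun]
  refine (Fintype.sum_of_injective _ injective_orderEmbedding_comp_perm _ _
    (fun f hf => ?_) fun _ => rfl).symm
  have hf' : ¬ Function.Injective f := fun h =>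
    let ⟨e, σ, hσ⟩ := exists_orderEmbedding_comp_perm h
    hf ⟨(e, σ), hσ⟩
  obtain ⟨i, j, hij, hne⟩ := Function.not_injective_iff.mp hf'
  rw [det_zero_of_column_eq hne fun l => congrArg (M l) hij, zero_mul]

end CauchyBinet

section CompoundMatrix

variable {R l m n : Type*} [CommRing R] [LinearOrder l] [LinearOrder m] [LinearOrder n]

/-- The `k`-th compound matrix of `A`: the matrix of its `k × k` minors, which represents the
`k`-th exterior power of `A`. The `k`-element sets of rows and of columns are encoded by their
increasing enumerations. -/
def compound (k : ℕ) (A : Matrix l m R) : Matrix (Fin k ↪o l) (Fin k ↪o m) R :=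
  of fun e f => (A.submatrix e f).det

lemma compound_mul [Fintype m] (k : ℕ) (A : Matrix l m R) (B : Matrix m n R) :
    compound k (A * B) = compound k A * compound k B := by
  ext e f
  exact (congrArg det (submatrix_mul A B e id f Function.bijective_id)).trans
    (det_mul_eq_sum_orderEmbedding _ _)

lemma compound_star [StarRing R] (k : ℕ) (A : Matrix m m R) :
    compound k (star A) = star (compound k A) := by
  ext e f
  exact det_conjTranspose (A.submatrix f e)

lemma compound_diagonal (k : ℕ) (d : m → R) :
    compound k (diagonal d) = diagonal fun e : Fin k ↪o m => ∏ i, d (e i) := by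
  ext e f
  simp only [compound, of_apply]
  rcases eq_or_ne e f with rfl | hef
  · rw [diagonal_apply_eq, submatrix_diagonal _ _ e.injective, det_diagonal]
    rfl
  · rw [diagonal_apply_ne _ hef]
    obtain ⟨i, hi⟩ : ∃ i, e i ∉ Set.range f := by
      by_contra! h
      refine hef (OrderEmbedding.range_inj.mp (Set.eq_of_subset_of_card_le
        (Set.range_subset_iff.mpr h) ?_))
      rw [Set.card_range_of_injective e.injective, Set.card_range_of_injective f.injective]
    exact det_eq_zero_of_row_eq_zero i fun j => diagonal_apply_ne _ fun h => hi ⟨j, h.symm⟩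

lemma compound_one (k : ℕ) : compound k (1 : Matrix m m R) = 1 := by
  rw [← diagonal_one, compound_diagonal]
  simp only [Finset.prod_const_one, diagonal_one]

lemma isUnit_compound [Fintype m] (k : ℕ) {A : Matrix m m R} (hA : IsUnit A) :
    IsUnit (compound k A) := by
  obtain ⟨B, hAB⟩ := hA.exists_right_inv
  exact IsUnit.of_mul_eq_one (compound k B) (by rw [← compound_mul, hAB, compound_one])

lemma compound_mem_unitaryGroup [Fintype m] [StarRing R] (k : ℕ) {V : Matrix m m R}
    (hV : V ∈ unitaryGroup m R) : compound k V ∈ unitaryGroup (Fin k ↪o m) R := by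
  rw [mem_unitaryGroup_iff] at hV ⊢
  rw [← compound_star, ← compound_mul, hV, compound_one]

end CompoundMatrix

section ComplexCompound

variable {m : Type*} [LinearOrder m] {A : Matrix m m ℂ}

lemma compound_unitary_conj_diagonal [Fintype m] (k : ℕ) (V : Matrix m m ℂ) (d : m → ℝ) :
    compound k (V * diagonal (fun i => (d i : ℂ)) * star V) = compound k V *
      diagonal (fun e : Fin k ↪o m => ((∏ i, d (e i) : ℝ) : ℂ)) * star (compound k V) := by
  simp only [compound_mul, compound_star, compound_diagonal, Complex.ofReal_prod]

lemma compound_nonneg [Finite m] (k : ℕ) (hA : 0 ≤ A) : 0 ≤ compound k A := by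
  have := Fintype.ofFinite m
  obtain ⟨B, rfl⟩ := CStarAlgebra.nonneg_iff_eq_star_mul_self.mp hA
  rw [compound_mul, compound_star]
  exact star_mul_self_nonneg _

lemma compound_isStrictlyPositive [Fintype m] (k : ℕ) (hA : IsStrictlyPositive A) :
    IsStrictlyPositive (compound k A) :=
  (isUnit_compound k hA.isUnit).isStrictlyPositive (compound_nonneg k hA.nonneg)

variable {n k : ℕ} {A B X : Matrix (Fin n) (Fin n) ℂ} {α p q : ℝ}

lemma compound_rpow (k : ℕ) (hX : 0 ≤ X) (x : ℝ) : compound k (X ^ x) = compound k X ^ x := by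
  have hX' := nonneg_iff_posSemidef.mp hX
  obtain ⟨V, hV, h⟩ := exists_unitary_eig hX'
  have h0 := eig_nonneg hX'
  rw [h, unitary_conj_diagonal_rpow hV h0, compound_unitary_conj_diagonal,
    compound_unitary_conj_diagonal, unitary_conj_diagonal_rpow (compound_mem_unitaryGroup k hV)
    fun e => Finset.prod_nonneg fun i _ => h0 (e i)]
  simp only [Real.finsetProd_rpow _ _ fun _ _ => h0 _]

lemma castLE_le_orderEmbedding (hk : k ≤ n) (e : Fin k ↪o Fin n) (i : Fin k) :
    Fin.castLE hk i ≤ e i := by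
  have hcard : (Finset.Iio i).card ≤ (Finset.Iio (e i)).card :=
    Finset.card_le_card_of_injOn e
      (fun j hj => Finset.mem_coe.mpr (Finset.mem_Iio.mpr (e.strictMono (Finset.mem_Iio.mp hj))))
      e.injective.injOn
  rwa [Fin.card_Iio, Fin.card_Iio] at hcard

lemma prod_val_lt_eq_prod_castLE {M : Type*} [CommMonoid M] (hk : k ≤ n) (f : Fin n → M) :
    ∏ i : Fin n with i.val < k, f i = ∏ i : Fin k, f (Fin.castLE hk i) := by
  have himage : (Finset.univ.filter fun i : Fin n => i.val < k) =
      Finset.univ.map (Fin.castLEEmb hk) := by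
    ext i
    simp only [Finset.mem_filter_univ, Finset.mem_map, Finset.mem_univ, true_and]
    exact ⟨fun hi => ⟨⟨i, hi⟩, rfl⟩, fun ⟨j, hj⟩ => hj ▸ j.isLt⟩
  rw [himage, Finset.prod_map]
  rfl

lemma norm_compound (hX : X.PosSemidef) (hk : k ≤ n) :
    ‖compound k X‖ = ∏ i : Fin n with i.val < k, eig hX i := by
  obtain ⟨V, hV, h⟩ := exists_unitary_eig hX
  have h0 := eig_nonneg hX
  conv_lhs => rw [h]
  rw [compound_unitary_conj_diagonal, prod_val_lt_eq_prod_castLE hk]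
  exact norm_unitary_conj_diagonal (compound_mem_unitaryGroup k hV)
    (fun e => Finset.prod_nonneg fun i _ => h0 (e i)) (i := Fin.castLEOrderEmb hk)
    fun e => Finset.prod_le_prod (fun i _ => h0 _) fun i _ =>
      eig_antitone hX (castLE_le_orderEmbedding hk e i)

lemma norm_compound_SG_le_norm_compound_R (k : ℕ) (hA : IsStrictlyPositive A) (hB : 0 ≤ B)
    (hα : 1 ≤ α) (hp : 0 < p) (hq : 0 < q) (hpq : p / q ≤ α) :
    ‖compound k (SG α p A B)‖ ≤ ‖compound k (R α q A B)‖ := by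
  have ha := compound_isStrictlyPositive k hA
  have hb := compound_nonneg k hB
  set a := compound k A
  set b := compound k B
  set G := geomMean (1 / 2) ((A ^ p) ^ (-1 : ℝ)) (B ^ p)
  have hG : 0 ≤ G := geomMean_nonneg _ _ _
  have hg := compound_nonneg k hG
  set g := compound k G
  have hriccati : g * a ^ p * g = b ^ p := by
    rw [← compound_rpow k hA.nonneg, ← compound_rpow k hB, ← compound_mul, ← compound_mul,
      geomMean_riccati (.rpow A p) CFC.rpow_nonneg]
  have hSG : compound k (SG α p A B) = (g ^ α * a ^ p * g ^ α) ^ (1 / p) := by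
    rw [SG, compound_rpow k (specGeomMean_nonneg α CFC.rpow_nonneg _), specGeomMean,
      compound_mul, compound_mul, compound_rpow k hG, compound_rpow k hA.nonneg]
  have hR : compound k (R α q A B) =
      (a ^ ((1 - α) / 2 * q) * b ^ (α * q) * a ^ ((1 - α) / 2 * q)) ^ (1 / q) := by
    rw [R, compound_rpow k (conjugate_nonneg_of_nonneg CFC.rpow_nonneg CFC.rpow_nonneg),
      compound_mul, compound_mul, compound_rpow k hA.nonneg, compound_rpow k hB]
  rw [hSG, hR, CFC.norm_rpow _ (by positivity)
    (conjugate_nonneg_of_nonneg CFC.rpow_nonneg CFC.rpow_nonneg), CFC.norm_rpow _ (by positivity)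
    (conjugate_nonneg_of_nonneg CFC.rpow_nonneg CFC.rpow_nonneg)]
  refine (Real.rpow_le_rpow (norm_nonneg _) (norm_rpow_conj_le ha hb hg hα hp hq hpq hriccati)
    (by positivity)).trans_eq ?_
  rw [← Real.rpow_mul (norm_nonneg _)]
  congr 1
  field_simp

theorem logMajorizedBy_SG_R_of_isStrictlyPositive (hA : IsStrictlyPositive A) (hB : 0 ≤ B)
    (hα : 1 ≤ α) (hp : 0 < p) (hq : 0 < q) (hpq : p / q ≤ α) :
    LogMajorizedBy (SG α p A B) (R α q A B) (SG_posSemidef α p A B) (R_posSemidef α q A B) := by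
  refine ⟨fun k _ hk => ?_, ?_⟩
  · rw [← norm_compound _ hk, ← norm_compound _ hk]
    exact norm_compound_SG_le_norm_compound_R k hA hB hα hp hq hpq
  · rw [← norm_det_eq_prod_eig, ← norm_det_eq_prod_eig, norm_det_SG hA hB hp.ne',
      norm_det_R hA hB hq.ne']

theorem logMajorizedBy_SG_R (hA : 0 ≤ A) (hB : 0 ≤ B) (h : supp B ≤ supp A)
    (hα : 1 < α) (hp : 0 < p) (hq : 0 < q) (hpq : p / q ≤ α) :
    LogMajorizedBy (SG α p A B) (R α q A B) (SG_posSemidef α p A B) (R_posSemidef α q A B) := by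
  have hAB := supp_mul_of_supp_le hB h
  have := logMajorizedBy_SG_R_of_isStrictlyPositive (unitExtension_isStrictlyPositive hA) hB hα.le
    hp hq hpq
  simpa only [SG_unitExtension hA hB hAB (zero_lt_one.trans hα).ne' hp.ne',
    R_unitExtension hA hB hAB hα hq] using this

end ComplexCompound

end Compound

section Counterexample

open Matrix Filter Topology

section RankOne

variable {n : ℕ} {A P : Matrix (Fin n) (Fin n) ℂ} {a b α p q : ℝ}

lemma norm_R_of_isStarProjection (hA : IsStrictlyPositive A) (hP : IsStarProjection P)
    (h0 : P ≠ 0) (hα : α ≠ 0) (hq : 0 < q) (hb : 0 ≤ b) (h : P * A ^ ((1 - α) * q) * P = b • P) :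
    ‖R α q A P‖ = b ^ (1 / q) := by
  rw [R, rpow_of_isStarProjection hP (mul_ne_zero hα hq.ne'), CFC.norm_rpow _ (by positivity)
    (conjugate_nonneg_of_nonneg hP.nonneg CFC.rpow_nonneg),
    norm_rpow_conj_of_isStarProjection hA hP, show 2 * ((1 - α) / 2 * q) = (1 - α) * q by ring, h,
    norm_smul, norm_of_isStarProjection hP h0, mul_one, Real.norm_of_nonneg hb]

lemma geomMean_of_isStarProjection (hA : IsStrictlyPositive A) (hP : IsStarProjection P)
    (ha : 0 < a) (h : P * A * P = a • P) :
    geomMean (1 / 2) (A ^ (-1 : ℝ)) P = a ^ (-(1 / 2) : ℝ) • P := by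
  refine geomMean_eq_of_riccati hA (smul_nonneg (by positivity) hP.nonneg) ?_
  have ha1 : a ^ (-(1 / 2) : ℝ) * (a ^ (-(1 / 2) : ℝ) * a) = 1 := by
    rw [← mul_assoc, ← Real.rpow_add ha, ← Real.rpow_add_one ha.ne']
    norm_num
  simp only [smul_mul_assoc, mul_smul_comm, h, smul_smul]
  rw [ha1, one_smul]

lemma SG_of_isStarProjection (hA : IsStrictlyPositive A) (hP : IsStarProjection P) (hα : 0 < α)
    (hp : 0 < p) (ha : 0 < a) (h : P * A ^ p * P = a • P) :
    SG α p A P = (a ^ (1 - α)) ^ (1 / p) • P := by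
  have hscalar : (a ^ (-(1 / 2) : ℝ)) ^ α * ((a ^ (-(1 / 2) : ℝ)) ^ α * a) = a ^ (1 - α) := by
    rw [← Real.rpow_mul ha.le, ← Real.rpow_add_one ha.ne', ← Real.rpow_add ha]
    ring_nf
  rw [SG, specGeomMean, rpow_of_isStarProjection hP hp.ne',
    geomMean_of_isStarProjection (.rpow A p) hP ha h, smul_rpow hP.nonneg (by positivity) hα.le,
    rpow_of_isStarProjection hP hα.ne']
  simp only [smul_mul_assoc, mul_smul_comm, h, smul_smul]
  rw [hscalar, smul_rpow hP.nonneg (by positivity) (by positivity),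
    rpow_of_isStarProjection hP (by positivity)]

end RankOne

/-- The projection of `ℂ²` onto the span of `(1, 1)`. -/
noncomputable def diagProj : Matrix (Fin 2) (Fin 2) ℂ := !![1 / 2, 1 / 2; 1 / 2, 1 / 2]

lemma diagProj_isStarProjection : IsStarProjection diagProj := by
  constructor
  · rw [IsIdempotentElem, diagProj]
    ext i j
    fin_cases i <;> fin_cases j <;> norm_num [mul_apply]
  · rw [IsSelfAdjoint, diagProj, star_eq_conjTranspose]
    ext i j
    fin_cases i <;> fin_cases j <;> simp

lemma diagProj_ne_zero : diagProj ≠ 0 := fun h => by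
  have h00 : (1 / 2 : ℂ) = 0 := congrFun (congrFun h 0) 0
  norm_num at h00

lemma diagonal_one_two_posDef : (diagonal ![(1 : ℂ), 2]).PosDef :=
  PosDef.diagonal fun i => by fin_cases i <;> simp

lemma diagonal_one_two_rpow (x : ℝ) :
    diagonal ![(1 : ℂ), 2] ^ x = diagonal ![1, ((2 ^ x : ℝ) : ℂ)] := by
  have hdiag (c : ℝ) : diagonal ![1, (c : ℂ)] =
      1 * diagonal (fun i => ((![1, c] : Fin 2 → ℝ) i : ℂ)) * star 1 := by
    rw [one_mul, star_one, mul_one]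
    congr 1
    ext i
    fin_cases i <;> simp
  have h12 : (0 : Fin 2 → ℝ) ≤ ![1, 2] := fun i => by fin_cases i <;> simp
  rw [hdiag, ← Complex.ofReal_ofNat, hdiag, unitary_conj_diagonal_rpow (one_mem _) h12]
  congr 3
  ext i
  fin_cases i <;> simp

lemma diagProj_conj_rpow (x : ℝ) :
    diagProj * diagonal ![(1 : ℂ), 2] ^ x * diagProj = ((1 + 2 ^ x) / 2 : ℝ) • diagProj := by
  rw [diagonal_one_two_rpow, diagProj]
  ext i j
  fin_cases i <;> fin_cases j <;>
    (simp [mul_apply, Fin.sum_univ_two, vecMul_diagonal]; ring)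

lemma two_rpow_half_lt {x : ℝ} (hx : x ≠ 0) : (2 : ℝ) ^ (x / 2) < (1 + 2 ^ x) / 2 := by
  have hsq : (2 : ℝ) ^ x = 2 ^ (x / 2) * 2 ^ (x / 2) := by
    rw [← Real.rpow_add two_pos, add_halves]
  have hne : (2 : ℝ) ^ (x / 2) ≠ 1 := by
    rcases hx.lt_or_gt with h | h
    · exact (Real.rpow_lt_one_of_one_lt_of_neg one_lt_two (by linarith)).ne
    · exact (Real.one_lt_rpow one_lt_two (by linarith)).ne'
  have hpos : 0 < ((2 : ℝ) ^ (x / 2) - 1) ^ 2 := sq_pos_of_ne_zero (sub_ne_zero.mpr hne)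
  nlinarith only [hsq, hpos]

variable {α p q : ℝ}

lemma norm_SG_diagProj_lt_norm_R_diagProj (hα : 1 < α) (hp : 0 < p) (hq : 0 < q) :
    ‖SG α p (diagonal ![1, 2]) diagProj‖ < ‖R α q (diagonal ![1, 2]) diagProj‖ := by
  have hA := diagonal_one_two_posDef.isStrictlyPositive
  have hP := diagProj_isStarProjection
  have hα0 : 0 < α := by linarith
  calc ‖SG α p (diagonal ![1, 2]) diagProj‖ = (((1 + 2 ^ p) / 2) ^ (1 - α)) ^ (1 / p) := by
        rw [SG_of_isStarProjection hA hP hα0 hp (by positivity) (diagProj_conj_rpow p), norm_smul,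
          norm_of_isStarProjection hP diagProj_ne_zero, mul_one,
          Real.norm_of_nonneg (by positivity)]
    _ < ((2 ^ (p / 2)) ^ (1 - α)) ^ (1 / p) :=
        Real.rpow_lt_rpow (by positivity) (Real.rpow_lt_rpow_of_neg (by positivity)
          (two_rpow_half_lt hp.ne') (by linarith)) (by positivity)
    _ = (2 ^ ((1 - α) * q / 2)) ^ (1 / q) := by
        rw [← Real.rpow_mul two_pos.le, ← Real.rpow_mul two_pos.le, ← Real.rpow_mul two_pos.le]
        congr 1
        field_simp
    _ < ((1 + 2 ^ ((1 - α) * q)) / 2) ^ (1 / q) :=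
        Real.rpow_lt_rpow (by positivity)
          (two_rpow_half_lt (mul_ne_zero (by linarith) hq.ne')) (by positivity)
    _ = ‖R α q (diagonal ![1, 2]) diagProj‖ :=
        (norm_R_of_isStarProjection hA hP diagProj_ne_zero hα0.ne' hq (by positivity)
          (diagProj_conj_rpow _)).symm

lemma posDef_add_smul_one {n : ℕ} {P : Matrix (Fin n) (Fin n) ℂ} (hP : 0 ≤ P) {ε : ℝ}
    (hε : 0 < ε) : (P + ε • 1).PosDef :=
  PosDef.posSemidef_add (nonneg_iff_posSemidef.mp hP) (PosDef.one.smul hε)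

lemma tendsto_add_smul_one_nhdsWithin {n : ℕ} {P : Matrix (Fin n) (Fin n) ℂ} (hP : 0 ≤ P) :
    Tendsto (fun ε : ℝ => P + ε • 1) (𝓝[>] 0) (𝓝[{B | 0 ≤ B}] P) := by
  have hcont : Continuous fun ε : ℝ => P + ε • (1 : Matrix (Fin n) (Fin n) ℂ) := by fun_prop
  refine tendsto_nhdsWithin_iff.mpr ⟨?_, eventually_mem_nhdsWithin.mono fun ε hε =>
    nonneg_iff_posSemidef.mpr (posDef_add_smul_one hP hε).posSemidef⟩
  simpa only [zero_smul, add_zero] using (hcont.tendsto 0).mono_left nhdsWithin_le_nhds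

lemma norm_le_norm_of_logMajorizedBy {n : ℕ} {X Y : Matrix (Fin n) (Fin n) ℂ}
    {hX : X.PosSemidef} {hY : Y.PosSemidef} (h : LogMajorizedBy X Y hX hY) : ‖X‖ ≤ ‖Y‖ := by
  obtain rfl | hn := n.eq_zero_or_pos
  · rw [Subsingleton.elim X Y]
  · have h1 := h.1 1 le_rfl hn
    rw [prod_val_lt_eq_prod_castLE hn, prod_val_lt_eq_prod_castLE hn, Fin.prod_univ_one,
      Fin.prod_univ_one] at h1
    exact (norm_eq_eig_zero hX hn).trans_le (h1.trans_eq (norm_eq_eig_zero hY hn).symm)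

theorem exists_not_logMajorizedBy_R_SG (hα : 1 < α) (hp : 0 < p) (hq : 0 < q) :
    ∃ A B : Matrix (Fin 2) (Fin 2) ℂ, A.PosDef ∧ B.PosDef ∧
      ¬ LogMajorizedBy (R α q A B) (SG α p A B) (R_posSemidef α q A B) (SG_posSemidef α p A B) := by
  have hα0 : 0 < α := by linarith
  have hP := diagProj_isStarProjection.nonneg
  have hlim := tendsto_add_smul_one_nhdsWithin hP
  have hSG := ((continuousOn_SG (diagonal ![1, 2]) hα0 hp _ hP).tendsto.comp hlim).norm
  have hR := ((continuousOn_R (diagonal ![1, 2]) hα0 hq _ hP).tendsto.comp hlim).norm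
  obtain ⟨ε, hlt, hε⟩ := ((hSG.eventually_lt hR (norm_SG_diagProj_lt_norm_R_diagProj hα hp hq)).and
    eventually_mem_nhdsWithin).exists
  exact ⟨_, _, diagonal_one_two_posDef, posDef_add_smul_one hP hε,
    fun h => (norm_le_norm_of_logMajorizedBy h).not_gt hlt⟩

end Counterexample

end QuasiMeans

theorem theorem3p4 (α p q : ℝ) (hα : 1 < α) (hp : 0 < p) (hq : 0 < q) :
    (p / q ≤ α →
      ∀ (n : ℕ) (A B : Matrix (Fin n) (Fin n) ℂ), A.PosSemidef → B.PosSemidef →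
        QuasiMeans.supp B ≤ QuasiMeans.supp A →
        QuasiMeans.LogMajorizedBy (QuasiMeans.SG α p A B) (QuasiMeans.R α q A B)
          (QuasiMeans.SG_posSemidef α p A B) (QuasiMeans.R_posSemidef α q A B)) ∧
    (∃ A B : Matrix (Fin 2) (Fin 2) ℂ, A.PosDef ∧ B.PosDef ∧
      ¬ QuasiMeans.LogMajorizedBy (QuasiMeans.R α q A B) (QuasiMeans.SG α p A B)
          (QuasiMeans.R_posSemidef α q A B) (QuasiMeans.SG_posSemidef α p A B)) :=
  ⟨fun hpq _ _ _ hA hB h => QuasiMeans.logMajorizedBy_SG_R (Matrix.nonneg_iff_posSemidef.mpr hA)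
    (Matrix.nonneg_iff_posSemidef.mpr hB) h hα hp hq hpq,
    QuasiMeans.exists_not_logMajorizedBy_R_SG hα hp hq⟩
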